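/- Let $\mu$ be an odd prime and let $g\in\mathbb{Q}[x]$ be an irreducible polynomial of degree $\mu$ that is solvable by radicals over $\mathbb{Q}$. Call a tuple $(f,v,r_1,\dots,r_v,\delta,w,c_0,\dots,c_{\mu-1})$ a *Kronecker formula* for $g$ if * $f\in\mathbb{Q}[x]$ is monic and irreducible of degree $v$, where $v\mid\mu-1$, its Galois group over $\mathbb{Q}$ is cyclic, and $r_1,\dots,r_v$ are its distinct complex roots, listed in some order; * $\delta$ is a positive integer whose multiplicative order modulo $\mu$ is $v$; * $w\in\mathbb{C}$ satisfies $w^{\mu}=r_1^{\delta^{v-1}}r_2^{\delta^{v-2}}\cdots r_v$, and $w^\mu$ is not the $\mu$th power of an element of $\mathbb{Q}(r_1,\dots,r_v)$; * $c_0,\dots,c_{\mu-1}\in\mathbb{Q}(r_1,\dots,r_v)$, and $c_0+c_1w+\cdots+c_{\mu-1}w^{\mu-1}$ is a root of $g$. Then $g$ has a Kronecker formula. Moreover, for every Kronecker formula for $g$ one has $c_0,\dots,c_{\mu-1}\in\mathbb{Q}(r_1)$, and the numbers $$x_j=\sum_{t=0}^{\mu-1}c_t\left(w\,e^{2\pi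 i j/\mu}\right)^{t},\qquad j=1,\dots,\mu,$$ are pairwise distinct and are exactly the complex roots of $g$. -/

import Mathlib

open Polynomial

/-- A rational polynomial is solvable by radicals over `ℚ` if all its complex roots can be obtained
from rational numbers by field operations and extraction of `n`-th roots, `n ≥ 1`. -/
def IsSolvableByRadicals (g : ℚ[X]) : Prop :=
  ∀ x ∈ g.rootSet ℂ, x ∈ solvableByRad ℚ ℂ

/-- Kronecker's formula, in the form of Edwards, for one root of the polynomial `g` of degree `μ`.
The values `r 1, …, r v` are the roots of a cyclic polynomial `f` of degree `v ∣ μ - 1`, and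
`c 0 + c 1 * w + ⋯ + c (μ - 1) * w ^ (μ - 1)` is a root of `g`; the other values of the
sequences `r` and `c` are irrelevant. -/
structure IsKroneckerFormula (g : ℚ[X]) (μ : ℕ) (f : ℚ[X]) (v : ℕ) (r : ℕ → ℂ) (δ : ℕ)
    (w : ℂ) (c : ℕ → ℂ) : Prop where
  monic : f.Monic
  irreducible : Irreducible f
  cyclic : IsCyclic f.Gal
  natDegree_eq : f.natDegree = v
  dvd : v ∣ μ - 1
  /-- `r 1, …, r v` is a list without repetition of all the roots of `f`. -/
  roots : Set.BijOn r (Set.Icc 1 v) (f.rootSet ℂ)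
  pos : 0 < δ
  /-- The order of `δ` modulo `μ` is `v`. -/
  order : orderOf (δ : ZMod μ) = v
  /-- `w` is a `μ`-th root of `r₁ ^ δ ^ (v - 1) * r₂ ^ δ ^ (v - 2) * ⋯ * rᵥ`. -/
  pow_eq : w ^ μ = ∏ i ∈ Finset.Icc 1 v, r i ^ δ ^ (v - i)
  /-- The radicand `w ^ μ` is not a `μ`-th power in `ℚ(r₁, …, rᵥ)`. -/
  not_pow : ∀ y ∈ IntermediateField.adjoin ℚ (r '' Set.Icc 1 v), y ^ μ ≠ w ^ μ
  coeff_mem : ∀ t < μ, c t ∈ IntermediateField.adjoin ℚ (r '' Set.Icc 1 v)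
  isRoot : aeval (∑ t ∈ Finset.range μ, c t * w ^ t) g = 0

/-! Existence. A solvable transitive group of prime degree `μ` is affine (Galois), so the roots can
be indexed as `x_i`, `i` modulo `μ`, with every `γ` acting by `i ↦ a(γ) i + b`. With `χ` the
cyclotomic character and `ψ = χ / a`, `γ` sends the Lagrange resolvent `ρ_j` to a root of unity
times `ρ_{ψ(γ) j}`. Let `δ` represent a generator `ψ(τ)` of the image of `ψ`, of order `v`. The
fixed field `K` of `ker ψ` is cyclic of degree `v`. If `k ≠ 0` and `ρ_k ≠ 0`, a suitable product `w`
of powers of the `ρ_{k δ^i}` and of elements of `K` transforms under `ker ψ` like `ρ_k`, and `w ^ μ`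
has the prescribed shape in the conjugates of a generator `y` of `K`. Then `ρ_{k t} / w ^ t` lies in
`K`, and `μ x_0 = ∑ ρ_{k t}` is the formula (`exists_resolvents`, `exists_kronecker_of_resolvents`).
Converse. `K = ℚ(r₁, …, rᵥ)` equals `ℚ(r₁)`, because subextensions of abelian extensions are normal.
Its degree `v < μ` is too small for a root of `g`, so the given root generates the Kummer extension
`K(w)` of degree `μ`, and the embeddings `w ↦ w ζ ^ j` give `μ` distinct roots (`isKummer_injOn`).
-/

/-! ### Solvable transitive groups of prime degree -/

/-- A nontrivial solvable group has a nontrivial normal abelian subgroup. -/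
theorem Group.IsSolvable.exists_normal_abelian (G : Type*) [Group G] [Group.IsSolvable G]
    [Nontrivial G] : ∃ A : Subgroup G, A.Normal ∧ A ≠ ⊥ ∧ ∀ a ∈ A, ∀ b ∈ A, a * b = b * a := by
  classical
  have hex := Group.IsSolvable.solvable (G := G)
  have h0 : Nat.find hex ≠ 0 := by
    intro h
    have := Nat.find_spec hex
    rw [h, derivedSeries_zero] at this
    exact top_ne_bot this
  obtain ⟨n, hn⟩ := Nat.exists_eq_succ_of_ne_zero h0
  refine ⟨derivedSeries G n, derivedSeries_normal G n, Nat.find_min hex (by omega), ?_⟩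
  intro a ha b hb
  have h1 : derivedSeries G (n + 1) = ⊥ := by
    have := Nat.find_spec hex
    rwa [hn] at this
  have h2 := Subgroup.commutator_mem_commutator ha hb
  rw [← derivedSeries_succ, h1, Subgroup.mem_bot] at h2
  exact commutatorElement_eq_one_iff_mul_comm.1 h2

/-- Galois: a faithful transitive action of a solvable group on a set of prime order contains a
regular normal cyclic subgroup. -/
theorem exists_regular_normal_of_solvable_of_prime_card {G X : Type*} [Group G] [MulAction G X]
    [FaithfulSMul G X] [MulAction.IsPretransitive G X] [Group.IsSolvable G] {p : ℕ}
    (hp : p.Prime) (hX : Nat.card X = p) :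
    ∃ s : G, s ^ p = 1 ∧ (∀ x y : X, ∃ m : ℕ, s ^ m • x = y) ∧
      ∀ γ : G, ∃ a : ℕ, γ * s * γ⁻¹ = s ^ a := by
  have : Fact p.Prime := ⟨hp⟩
  have : Finite X := Nat.finite_of_card_ne_zero (hX ▸ hp.ne_zero)
  have : Nontrivial X := (Finite.one_lt_card_iff_nontrivial).1 (hX ▸ hp.one_lt)
  have : Finite G := Finite.of_injective (MulAction.toPerm : G → Equiv.Perm X)
    MulAction.toPerm_injective
  have : Nontrivial G := by
    obtain ⟨x, y, hxy⟩ := exists_pair_ne X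
    obtain ⟨γ, hγ⟩ := MulAction.exists_smul_eq G x y
    exact ⟨γ, 1, by rintro rfl; exact hxy (by simpa using hγ)⟩
  -- Prime degree forces primitivity, so a normal subgroup acting nontrivially is transitive.
  have : MulAction.IsPreprimitive G X := MulAction.IsPreprimitive.of_prime_card (hX ▸ hp)
  obtain ⟨A, hA, hne, hcomm⟩ := Group.IsSolvable.exists_normal_abelian G
  have htrans : MulAction.IsPretransitive A X := by
    apply MulAction.IsQuasiPreprimitive.isPretransitive_of_normal (G := G)
    intro h
    apply hne
    rw [eq_bot_iff]
    intro a ha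
    rw [Subgroup.mem_bot]
    apply FaithfulSMul.eq_of_smul_eq_smul (α := X)
    intro x
    have hx : x ∈ MulAction.fixedPoints A X := h ▸ Set.mem_univ x
    rw [one_smul]
    exact hx ⟨a, ha⟩
  -- A transitive commutative group is free: elements agreeing at one point agree at all its
  -- translates.
  have hfree : ∀ a ∈ A, ∀ b ∈ A, ∀ x : X, a • x = b • x → a = b := by
    intro a ha b hb x hx
    apply FaithfulSMul.eq_of_smul_eq_smul (α := X)
    intro y
    obtain ⟨c, rfl⟩ := MulAction.exists_smul_eq A x y
    change a • (c : G) • x = b • (c : G) • x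
    rw [← mul_smul, ← mul_smul, hcomm a ha c c.2, hcomm b hb c c.2, mul_smul, hx, mul_smul]
  have hcard : Nat.card A = p := by
    obtain ⟨x⟩ : Nonempty X := inferInstance
    rw [← hX]
    refine Nat.card_eq_of_bijective (fun a : A => a • x) ⟨?_, ?_⟩
    · intro a b hab
      exact Subtype.ext (hfree a a.2 b b.2 x hab)
    · exact fun y => MulAction.exists_smul_eq A x y
  have : IsCyclic A := isCyclic_of_prime_card hcard
  obtain ⟨s, hs⟩ := IsCyclic.exists_generator (α := A)
  have hpow : ∀ a ∈ A, ∃ m : ℕ, (s : G) ^ m = a := by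
    intro a ha
    obtain ⟨m, hm⟩ := (mem_powers_iff_mem_zpowers).2 (hs ⟨a, ha⟩)
    exact ⟨m, by simpa using congrArg Subtype.val hm⟩
  refine ⟨s, ?_, ?_, ?_⟩
  · have := pow_card_eq_one' (x := s)
    rw [hcard] at this
    simpa using congrArg Subtype.val this
  · intro x y
    obtain ⟨a, ha⟩ := MulAction.exists_smul_eq A x y
    obtain ⟨m, hm⟩ := hpow a a.2
    exact ⟨m, by rw [hm]; exact ha⟩
  · intro γ
    obtain ⟨m, hm⟩ := hpow _ (hA.conj_mem s s.2 γ)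
    exact ⟨m, hm.symm⟩

/-- Galois: a transitive action of a solvable group on a set of prime order `p` is an action by
affine transformations of `ZMod p`, the translation by `1` being one of them. -/
theorem exists_affine_of_solvable_of_prime_card {Γ X : Type*} [Group Γ] [MulAction Γ X]
    [MulAction.IsPretransitive Γ X] [Group.IsSolvable Γ] {p : ℕ}
    (hp : p.Prime) (hX : Nat.card X = p) :
    ∃ (e : ZMod p ≃ X) (a : Γ →* (ZMod p)ˣ),
      (∀ γ : Γ, ∃ b : ZMod p, ∀ i, γ • e i = e (a γ * i + b)) ∧
      ∃ σ : Γ, ∀ i, σ • e i = e (i + 1) := by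
  have : Fact p.Prime := ⟨hp⟩
  have : Finite X := Nat.finite_of_card_ne_zero (hX ▸ hp.ne_zero)
  obtain ⟨x⟩ : Nonempty X := Finite.card_pos_iff.1 (hX ▸ hp.pos)
  -- The action of `Γ` need not be faithful; its image in the permutations is.
  let φ := MulAction.toPermHom Γ X
  have : Group.IsSolvable φ.range := Group.isSolvable_of_surjective φ.rangeRestrict_surjective
  have : MulAction.IsPretransitive φ.range X := by
    refine ⟨fun x y => ?_⟩
    obtain ⟨γ, hγ⟩ := MulAction.exists_smul_eq Γ x y
    exact ⟨⟨φ γ, γ, rfl⟩, hγ⟩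
  obtain ⟨⟨_, σ, rfl⟩, hsp, htr, hconj⟩ :=
    exists_regular_normal_of_solvable_of_prime_card (G := φ.range) hp hX
  have hφ : ∀ (m : ℕ) (y : X), (φ σ ^ m) y = σ ^ m • y := fun m y => by
    rw [← map_pow]; rfl
  have hsp' : ∀ y : X, σ ^ p • y = y := fun y => by
    have := congrArg (fun q : φ.range => (q : Equiv.Perm X) y) hsp
    simpa [hφ] using this
  have htr' : ∀ y z : X, ∃ m : ℕ, σ ^ m • y = z := fun y z => by
    obtain ⟨m, hm⟩ := htr y z
    exact ⟨m, by rw [← hm, ← hφ]; rfl⟩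
  have hconj' : ∀ γ : Γ, ∃ a : ℕ, ∀ y : X, γ • σ • y = σ ^ a • γ • y := fun γ => by
    obtain ⟨m, hm⟩ := hconj ⟨φ γ, γ, rfl⟩
    refine ⟨m, fun y => ?_⟩
    have := congrArg (fun q : φ.range => (q : Equiv.Perm X) (γ • y)) hm
    change γ • σ • γ⁻¹ • γ • y = (φ σ ^ m) (γ • y) at this
    rwa [inv_smul_smul, hφ] at this
  have hmul : ∀ (m : ℕ) (y : X), σ ^ (p * m) • y = y := by
    intro m y
    induction m with
    | zero => simp
    | succ k ih => rw [mul_add, pow_add, mul_smul, mul_one, hsp', ih]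
  have hmod : ∀ (m : ℕ) (y : X), σ ^ m • y = σ ^ (m % p) • y := fun m y => by
    conv_lhs => rw [← Nat.mod_add_div m p, pow_add, mul_smul, hmul]
  have hbij : Function.Bijective (fun i : ZMod p => σ ^ i.val • x) := by
    have hsurj : Function.Surjective (fun i : ZMod p => σ ^ i.val • x) := by
      intro y
      obtain ⟨m, hm⟩ := htr' x y
      refine ⟨m, ?_⟩
      simp only [ZMod.val_natCast]
      rw [← hmod, hm]
    exact hsurj.bijective_of_nat_card_le (by rw [hX]; simp)
  let e := Equiv.ofBijective _ hbij
  have he : ∀ m : ℕ, e (m : ZMod p) = σ ^ m • x := fun m => by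
    change σ ^ (m : ZMod p).val • x = _
    rw [ZMod.val_natCast, ← hmod]
  have haff : ∀ γ : Γ, ∃ a b : ZMod p, ∀ i, γ • e i = e (a * i + b) := by
    intro γ
    obtain ⟨a, ha⟩ := hconj' γ
    obtain ⟨b, hb⟩ := htr' x (γ • x)
    refine ⟨a, b, fun i => ?_⟩
    obtain ⟨m, rfl⟩ := ZMod.natCast_zmod_surjective i
    rw [he, ← Nat.cast_mul, ← Nat.cast_add, he, pow_add, mul_smul, hb]
    induction m with
    | zero => simp
    | succ k ih => rw [pow_succ', mul_smul, ha, ih, mul_add, mul_one, add_comm, pow_add, mul_smul]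
  choose a b hab using haff
  -- The slope of an affine map is its value at 1 minus its value at 0; hence it is multiplicative
  -- in `γ`.
  have h1 : a 1 = 1 := by
    have h0 := hab 1 0
    have h1 := hab 1 1
    rw [one_smul, e.injective.eq_iff] at h0 h1
    linear_combination h0 - h1
  have hm : ∀ γ γ', a (γ * γ') = a γ * a γ' := by
    intro γ γ'
    have h0 := hab (γ * γ') 0
    have h1 := hab (γ * γ') 1
    rw [mul_smul, hab, hab, e.injective.eq_iff] at h0 h1
    linear_combination h0 - h1
  let A : Γ →* ZMod p := { toFun := a, map_one' := h1, map_mul' := hm }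
  refine ⟨e, A.toHomUnits, fun γ => ⟨b γ, fun i => ?_⟩, σ, fun i => ?_⟩
  · rw [hab]; rfl
  · obtain ⟨m, rfl⟩ := ZMod.natCast_zmod_surjective i
    rw [he, ← Nat.cast_succ, he, pow_succ', mul_smul]

/-! ### Every Kronecker formula gives all the roots -/

section
variable {g f : ℚ[X]} {μ v δ : ℕ} {r c : ℕ → ℂ} {w : ℂ}

theorem IsKroneckerFormula.pos_degree (h : IsKroneckerFormula g μ f v r δ w c) : 0 < v :=
  h.natDegree_eq ▸ h.irreducible.natDegree_pos

theorem IsKroneckerFormula.minpoly_eq (h : IsKroneckerFormula g μ f v r δ w c) :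
    minpoly ℚ (r 1) = f := by
  have h1 : r 1 ∈ f.rootSet ℂ := h.roots.mapsTo ⟨le_rfl, h.pos_degree⟩
  exact (minpoly.eq_of_irreducible_of_monic h.irreducible (mem_rootSet.1 h1).2 h.monic).symm

/-- A root of a cyclic polynomial generates the field generated by all its roots. -/
theorem adjoin_rootSet_eq_adjoin_root {F E : Type*} [Field F] [Field E] [Algebra F E] {f : F[X]}
    (hf : Irreducible f) (hsep : f.Separable) (hsplit : (f.map (algebraMap F E)).Splits)
    (hcyc : IsCyclic f.Gal) {x : E} (hx : x ∈ f.rootSet E) :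
    IntermediateField.adjoin F (f.rootSet E) = IntermediateField.adjoin F {x} := by
  have := IntermediateField.adjoin_rootSet_isSplittingField hsplit
  set K := IntermediateField.adjoin F (f.rootSet E) with hK
  have : IsGalois F K := IsGalois.of_separable_splitting_field hsep
  have : IsCyclic Gal(f.SplittingField/F) := hcyc
  have : IsCyclic Gal(K/F) :=
    isCyclic_of_surjective
      (AlgEquiv.autCongr (IsSplittingField.algEquiv K f).symm : f.Gal ≃* Gal(K/F))
      (MulEquiv.surjective _)
  have : IsAbelianGalois F K := IsAbelianGalois.of_isCyclic F K
  have hle : IntermediateField.adjoin F {x} ≤ K :=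
    IntermediateField.adjoin.mono _ _ _ (by simpa using hx)
  apply le_antisymm _ hle
  -- Subextensions of an abelian extension are normal, so all the roots of `f` already lie in
  -- `F(x)`.
  have : IsAbelianGalois F (IntermediateField.adjoin F {x}) :=
    IsAbelianGalois.of_algHom (IntermediateField.inclusion hle)
  have hs := (inferInstance : Normal F (IntermediateField.adjoin F {x})).splits
    (IntermediateField.AdjoinSimple.gen F x)
  rw [IntermediateField.minpoly_gen,
    ← minpoly.eq_of_irreducible hf (mem_rootSet.1 hx).2, Polynomial.map_mul, map_C] at hs
  have hs' := hs.of_dvd (mul_ne_zero (map_ne_zero hf.ne_zero) (by simpa using hf.ne_zero))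
    (Dvd.intro _ rfl)
  rw [hK, IntermediateField.adjoin_le_iff,
    ← hs'.image_rootSet (IntermediateField.adjoin F {x}).val]
  rintro _ ⟨y, -, rfl⟩
  exact y.2

theorem IsKroneckerFormula.adjoin_eq (h : IsKroneckerFormula g μ f v r δ w c) :
    IntermediateField.adjoin ℚ (r '' Set.Icc 1 v) = IntermediateField.adjoin ℚ {r 1} := by
  have h1 : r 1 ∈ f.rootSet ℂ := h.roots.mapsTo ⟨le_rfl, h.pos_degree⟩
  rw [h.roots.image_eq]
  exact adjoin_rootSet_eq_adjoin_root h.irreducible h.irreducible.separable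
    (IsAlgClosed.splits _) h.cyclic h1

theorem natDegree_minpoly_dvd_finrank {F E : Type*} [Field F] [Field E] [Algebra F E]
    (K : IntermediateField F E) [FiniteDimensional F K] {x : E} (hx : x ∈ K) :
    (minpoly F x).natDegree ∣ Module.finrank F K := by
  have h := minpoly.degree_dvd (K := F) (x := (⟨x, hx⟩ : K)) (Algebra.IsIntegral.isIntegral _)
  rwa [← minpoly.algebraMap_eq (algebraMap K E).injective] at h

/-- If a polynomial `∑ c t * w ^ t` over `K` in a Kummer generator `w` of prime degree is not
in `K`, then it is not fixed by any change of the generator. -/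
theorem isKummer_injOn {F E : Type*} [Field F] [Field E] [Algebra F E]
    (K : IntermediateField F E) {p : ℕ} (hp : p.Prime)
    {w : E} (hw : w ^ p ∈ K) (hnp : ∀ y ∈ K, y ^ p ≠ w ^ p) {c : ℕ → E}
    (hc : ∀ t < p, c t ∈ K) (hx : ∑ t ∈ Finset.range p, c t * w ^ t ∉ K) (g : F[X])
    (hg : aeval (∑ t ∈ Finset.range p, c t * w ^ t) g = 0) :
    (∀ w', w' ^ p = w ^ p → aeval (∑ t ∈ Finset.range p, c t * w' ^ t) g = 0) ∧
    ∀ w' w'', w' ^ p = w ^ p → w'' ^ p = w ^ p →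
      ∑ t ∈ Finset.range p, c t * w' ^ t = ∑ t ∈ Finset.range p, c t * w'' ^ t → w' = w'' := by
  have hirr : Irreducible (X ^ p - C (⟨w ^ p, hw⟩ : K)) :=
    X_pow_sub_C_irreducible_of_prime hp
      (fun b hb => hnp b b.2 (by simpa using congrArg Subtype.val hb))
  have hroot : ∀ w', w' ^ p = w ^ p → aeval w' (X ^ p - C (⟨w ^ p, hw⟩ : K)) = 0 := by
    intro w' h; simp [h]
  have hmin : minpoly K w = X ^ p - C (⟨w ^ p, hw⟩ : K) :=
    (minpoly.eq_of_irreducible_of_monic hirr (hroot w rfl)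
      (monic_X_pow_sub_C _ hp.ne_zero)).symm
  have hint : IsIntegral K w := ⟨_, monic_X_pow_sub_C _ hp.ne_zero, hroot w rfl⟩
  have hfin : Module.finrank K (IntermediateField.adjoin K {w}) = p := by
    rw [IntermediateField.adjoin.finrank hint, hmin, natDegree_X_pow_sub_C]
  let γ := IntermediateField.AdjoinSimple.gen K w
  have hex : ∀ w', w' ^ p = w ^ p → ∃ φ : IntermediateField.adjoin K {w} →ₐ[K] E, φ γ = w' := by
    intro w' h
    refine ⟨(IntermediateField.algHomAdjoinIntegralEquiv K hint).symm ⟨w', ?_⟩,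
      IntermediateField.algHomAdjoinIntegralEquiv_symm_apply_gen K hint _⟩
    rw [mem_aroots, hmin]
    exact ⟨hirr.ne_zero, hroot w' h⟩
  let x : IntermediateField.adjoin K {w} :=
    ∑ t ∈ Finset.range p, algebraMap K _ (if ht : t < p then ⟨c t, hc t ht⟩ else 0) * γ ^ t
  have hφ : ∀ φ : IntermediateField.adjoin K {w} →ₐ[K] E,
      φ x = ∑ t ∈ Finset.range p, c t * (φ γ) ^ t := by
    intro φ
    rw [map_sum]
    refine Finset.sum_congr rfl fun t ht => ?_
    rw [map_mul, map_pow, AlgHom.commutes, dif_pos (Finset.mem_range.1 ht)]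
    rfl
  have hxv : (x : E) = ∑ t ∈ Finset.range p, c t * w ^ t :=
    hφ (IntermediateField.adjoin K {w}).val
  have hgx : aeval x (g.map (algebraMap F K)) = 0 := by
    apply (algebraMap (IntermediateField.adjoin K {w}) E).injective
    rw [← aeval_algebraMap_apply, map_zero, aeval_map_algebraMap]
    change aeval (x : E) g = 0
    rwa [hxv]
  constructor
  · intro w' h
    obtain ⟨φ, hφw⟩ := hex w' h
    rw [← hφw, ← hφ]
    rw [← aeval_map_algebraMap K, aeval_algHom_apply, hgx, map_zero]
  · intro w' w'' h' h'' heq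
    obtain ⟨φ, hφw⟩ := hex w' h'
    obtain ⟨ψ, hψw⟩ := hex w'' h''
    have hsimple := IntermediateField.isSimpleOrder_of_finrank_prime K
      (IntermediateField.adjoin K {w}) (hfin ▸ hp)
    -- Prime degree leaves no intermediate field, so `x` generates `K(w)` and an embedding is
    -- determined by its value at `x`.
    have htop : IntermediateField.adjoin K {x} = ⊤ := by
      refine (hsimple.eq_bot_or_eq_top _).resolve_left fun hbot => hx ?_
      rw [IntermediateField.adjoin_simple_eq_bot_iff, IntermediateField.mem_bot] at hbot
      obtain ⟨y, hy⟩ := hbot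
      rw [← hxv, ← hy]
      exact y.2
    have : φ = ψ := by
      have hcomp : φ.comp (IntermediateField.val ⊤) = ψ.comp (IntermediateField.val ⊤) := by
        apply IntermediateField.algHom_ext_of_eq_adjoin _ htop.symm
        rintro _ rfl
        change φ x = ψ x
        rw [hφ, hφ, hφw, hψw, heq]
      ext y
      exact DFunLike.congr_fun hcomp ⟨y, IntermediateField.mem_top⟩
    rw [← hφw, ← hψw, this]

/-- Conjugating `w` over `K` yields `μ` distinct roots, and `g` has only `μ`. -/
theorem IsKroneckerFormula.bijOn (hμ : μ.Prime) (hdeg : g.natDegree = μ) (hirr : Irreducible g)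
    (h : IsKroneckerFormula g μ f v r δ w c) :
    Set.BijOn (fun j : ℕ => ∑ t ∈ Finset.range μ,
        c t * (w * Complex.exp (2 * Real.pi * Complex.I * j / μ)) ^ t)
      (Set.Icc 1 μ) (g.rootSet ℂ) := by
  set K := IntermediateField.adjoin ℚ (r '' Set.Icc 1 v) with hK
  have hrK : ∀ i ∈ Set.Icc 1 v, r i ∈ K := fun i hi =>
    IntermediateField.subset_adjoin _ _ ⟨i, hi, rfl⟩
  have hw : w ^ μ ∈ K := by
    rw [h.pow_eq]
    exact prod_mem fun i hi => pow_mem (hrK i (by simpa using hi)) _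
  have hw0 : w ≠ 0 := by
    rintro rfl
    exact h.not_pow 0 (zero_mem _) rfl
  have hint : IsIntegral ℚ (r 1) := by
    refine ⟨f, h.monic, (mem_rootSet.1 (h.roots.mapsTo ⟨le_rfl, h.pos_degree⟩)).2⟩
  have hfin : Module.finrank ℚ K = v := by
    rw [hK, h.adjoin_eq, IntermediateField.adjoin.finrank hint, h.minpoly_eq, h.natDegree_eq]
  set x := ∑ t ∈ Finset.range μ, c t * w ^ t
  -- A root of `g` in `K` would make `μ` divide `v`, hence `μ - 1`.
  have hxK : x ∉ K := by
    intro hxK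
    have hfin0 : FiniteDimensional ℚ K :=
      Module.finite_of_finrank_pos (hfin ▸ h.pos_degree)
    have hd := natDegree_minpoly_dvd_finrank K hxK
    have hm := congrArg natDegree (minpoly.eq_of_irreducible hirr h.isRoot)
    rw [natDegree_mul_C (by simpa using hirr.ne_zero), hdeg] at hm
    rw [hfin, ← hm] at hd
    have := Nat.le_of_dvd (Nat.sub_pos_of_lt hμ.one_lt) (hd.trans h.dvd)
    have := hμ.pos
    omega
  have hζ := Complex.isPrimitiveRoot_exp μ hμ.ne_zero
  set ζ := Complex.exp (2 * Real.pi * Complex.I / μ) with hζd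
  have hexp : ∀ j : ℕ, Complex.exp (2 * Real.pi * Complex.I * j / μ) = ζ ^ j := by
    intro j
    rw [hζd, ← Complex.exp_nat_mul]
    congr 1
    ring
  have hwj : ∀ j : ℕ, (w * ζ ^ j) ^ μ = w ^ μ := fun j => by
    rw [mul_pow, ← pow_mul, mul_comm j, pow_mul, hζ.pow_eq_one, one_pow, mul_one]
  obtain ⟨hroot, hinj⟩ := isKummer_injOn K hμ hw h.not_pow h.coeff_mem hxK g h.isRoot
  simp only [hexp]
  have hmaps : Set.MapsTo (fun j : ℕ => ∑ t ∈ Finset.range μ, c t * (w * ζ ^ j) ^ t)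
      (Set.Icc 1 μ) (g.rootSet ℂ) := fun j _ =>
    mem_rootSet.2 ⟨hirr.ne_zero, hroot _ (hwj j)⟩
  have hinjOn : Set.InjOn (fun j : ℕ => ∑ t ∈ Finset.range μ, c t * (w * ζ ^ j) ^ t)
      (Set.Icc 1 μ) := by
    rintro i ⟨hi1, hi2⟩ j ⟨hj1, hj2⟩ hij
    have h1 := mul_left_cancel₀ hw0 (hinj _ _ (hwj i) (hwj j) hij)
    -- Exponents run over `1, …, μ`; cancelling one factor `ζ` brings them below `μ`.
    obtain ⟨i, rfl⟩ := Nat.exists_eq_add_of_le' hi1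
    obtain ⟨j, rfl⟩ := Nat.exists_eq_add_of_le' hj1
    rw [pow_succ, pow_succ] at h1
    rw [hζ.pow_inj hi2 hj2 (mul_right_cancel₀ (hζ.ne_zero hμ.ne_zero) h1)]
  refine ⟨hmaps, hinjOn, ?_⟩
  have hcard : (g.rootSet ℂ).ncard = μ := by
    rw [← Nat.card_coe_set_eq, Nat.card_eq_fintype_card,
      card_rootSet_eq_natDegree hirr.separable (IsAlgClosed.splits _), hdeg]
  have himg := Set.eq_of_subset_of_ncard_le hmaps.image_subset
    (by rw [hcard, hinjOn.ncard_image, ← Finset.coe_Icc, Set.ncard_coe_finset]; simp)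
    (Set.toFinite _)
  exact himg.ge
end

/-! ### Lagrange resolvents and cyclic conjugates -/

/-- The Lagrange resolvents of a family `x i`, `i : ZMod p`. -/
def lagrangeResolvent {p : ℕ} [NeZero p] {M : Type*} [CommRing M] (e : AddChar (ZMod p) M)
    (x : ZMod p → M) (j : ZMod p) : M :=
  ∑ i, e (j * i) * x i

section
variable {p : ℕ} {F M : Type*} [Field F] [Field M] [Algebra F M] {ζ : M}

theorem IsPrimitiveRoot.map_zmodChar [NeZero p] (hζ : IsPrimitiveRoot ζ p) (γ : Gal(M/F))
    (i : ZMod p) :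
    γ (AddChar.zmodChar p hζ.pow_eq_one i) =
      AddChar.zmodChar p hζ.pow_eq_one (hζ.autToPow F γ * i) := by
  rw [AddChar.zmodChar_apply, map_pow, ← hζ.autToPow_spec F γ,
    ← AddChar.zmodChar_apply hζ.pow_eq_one, ← AddChar.map_nsmul_eq_pow, nsmul_eq_mul,
    ZMod.natCast_zmod_val, mul_comm]

/-- Substitute `a * i + b` for the summation index; the shift `b` comes out as a root of unity. -/
theorem map_lagrangeResolvent [NeZero p] (hζ : IsPrimitiveRoot ζ p) (γ : Gal(M/F))
    {x : ZMod p → M} (a : (ZMod p)ˣ) (b : ZMod p) (h : ∀ i, γ (x i) = x (a * i + b))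
    (j : ZMod p) :
    γ (lagrangeResolvent (AddChar.zmodChar p hζ.pow_eq_one) x j) =
      AddChar.zmodChar p hζ.pow_eq_one (-((hζ.autToPow F γ / a : (ZMod p)ˣ) * b) * j) *
      lagrangeResolvent (AddChar.zmodChar p hζ.pow_eq_one) x
        ((hζ.autToPow F γ / a : (ZMod p)ˣ) * j) := by
  unfold lagrangeResolvent
  rw [map_sum, Finset.mul_sum]
  refine Fintype.sum_equiv ((Units.mulLeft a).trans (Equiv.addRight b)) _ _ fun i => ?_
  rw [map_mul, hζ.map_zmodChar, h, ← mul_assoc _ _ (x _), ← AddChar.map_add_eq_mul]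
  simp only [Equiv.trans_apply, Units.mulLeft_apply, Equiv.coe_addRight]
  congr 2
  have : (hζ.autToPow F γ : ZMod p) = (hζ.autToPow F γ / a : (ZMod p)ˣ) * a := by
    rw [← Units.val_mul, div_mul_cancel]
  rw [this]
  ring

/-- Orthogonality of characters: summing over `j` kills every term with `i ≠ 0`. -/
theorem sum_lagrangeResolvent [NeZero p] (hζ : IsPrimitiveRoot ζ p) (x : ZMod p → M) :
    ∑ j, lagrangeResolvent (AddChar.zmodChar p hζ.pow_eq_one) x j = p * x 0 := by
  classical
  unfold lagrangeResolvent
  rw [Finset.sum_comm]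
  simp_rw [← Finset.sum_mul,
    AddChar.sum_mulShift _ (AddChar.zmodChar_primitive_of_primitive_root p hζ)]
  simp

/-- A Galois group acting on the `x i` by affine transformations acts monomially on the
resolvents. -/
theorem exists_resolvents [CharZero M] [hp : Fact p.Prime]
    (hζ : IsPrimitiveRoot ζ p) {x : ZMod p → M} (hx : Function.Injective x)
    (a : Gal(M/F) →* (ZMod p)ˣ)
    (ha : ∀ γ : Gal(M/F), ∃ b : ZMod p, ∀ i, γ (x i) = x (a γ * i + b))
    (hσ : ∃ σ : Gal(M/F), ∀ i, σ (x i) = x (i + 1)) :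
    ∃ (e : AddChar (ZMod p) M) (ψ : Gal(M/F) →* (ZMod p)ˣ) (ρ : ZMod p → M),
      IsPrimitiveRoot (e 1) p ∧
      (∀ γ, ∃ b, ∀ j, γ (ρ j) = e (b * j) * ρ (ψ γ * j)) ∧
      (∃ σ, ψ σ = 1 ∧ (∀ j, σ (e j) = e j) ∧ ∃ b ≠ 0, ∀ j, σ (ρ j) = e (b * j) * ρ j) ∧
      ∑ j, ρ j = p * x 0 ∧ ∃ k ≠ 0, ρ k ≠ 0 := by
  set e := AddChar.zmodChar p hζ.pow_eq_one with he
  let ρ := lagrangeResolvent e x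
  have hsum : ∑ j, ρ j = p * x 0 := sum_lagrangeResolvent hζ x
  obtain ⟨σ, hσ⟩ := hσ
  have hσn : ∀ (n : ℕ) (i), (σ ^ n) (x i) = x (i + n) := by
    intro n
    induction n with
    | zero => simp
    | succ n ih => intro i; rw [pow_succ', AlgEquiv.mul_apply, ih, hσ]; push_cast; ring_nf
  -- `σ` may move `ζ`. Its power `p - 1` is trivial under both characters and still translates the
  -- indices, by `-1`.
  have haσ : a (σ ^ (p - 1)) = 1 := by rw [map_pow, ZMod.units_pow_card_sub_one_eq_one]
  have hχσ : hζ.autToPow F (σ ^ (p - 1)) = 1 := by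
    rw [map_pow, ZMod.units_pow_card_sub_one_eq_one]
  have hcast : ((p - 1 : ℕ) : ZMod p) = -1 := by
    rw [Nat.cast_sub hp.out.one_lt.le]; simp
  have hσρ : ∀ j, (σ ^ (p - 1)) (ρ j) = e (1 * j) * ρ j := by
    intro j
    have := map_lagrangeResolvent (x := x) hζ (σ ^ (p - 1)) 1 (-1 : ZMod p)
      (fun i => by rw [hσn, hcast]; simp only [Units.val_one, one_mul]) j
    rw [hχσ] at this
    simpa using this
  refine ⟨e, hζ.autToPow F / a, ρ, ?_, ?_,
    ⟨σ ^ (p - 1), by simp [haσ, hχσ], ?_, 1, one_ne_zero, hσρ⟩, hsum, ?_⟩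
  · rwa [he, AddChar.zmodChar_apply, ZMod.val_one, pow_one]
  · intro γ
    obtain ⟨b, hb⟩ := ha γ
    exact ⟨_, fun j => map_lagrangeResolvent hζ γ (a γ) b hb j⟩
  · intro j
    rw [he, hζ.map_zmodChar, hχσ]; simp
  -- Otherwise `p * x 0 = ρ 0`, which `σ ^ (p - 1)` fixes, although it moves `x 0` to `x (-1)`.
  · by_contra! hcon
    have h0 : ρ 0 = p * x 0 := by
      rw [← hsum, Finset.sum_eq_single 0 (fun k _ hk => hcon k hk) (by simp)]
    have h1 := hσρ 0
    rw [mul_zero, AddChar.map_zero_eq_one, one_mul, h0, map_mul, map_natCast, hσn, hcast] at h1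
    have h2 := hx (mul_left_cancel₀ (by exact_mod_cast hp.out.ne_zero) h1)
    simp at h2

/-- A primitive element stays primitive after a suitable translation, raising to a power and
multiplication by a given element. -/
theorem exists_translate_pow_mul_ne [CharZero F] [FiniteDimensional F M] (A θ : M)
    (hA : A ≠ 0) {n : ℕ} (hn : n ≠ 0) :
    ∃ c : F, θ + algebraMap F M c ≠ 0 ∧ ∀ γ : Gal(M/F), γ θ ≠ θ →
      γ (A * (θ + algebraMap F M c) ^ n) ≠ A * (θ + algebraMap F M c) ^ n := by
  classical
  -- `P γ` vanishes at the translations that are bad for `γ`. It is a nonzero polynomial, as its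
  -- value at `-θ` shows, so the infinite field `F` contains a good translation.
  let P : Gal(M/F) → M[X] := fun γ =>
    if γ θ = θ then 1 else C (γ A) * (C (γ θ) + X) ^ n - C A * (C θ + X) ^ n
  have hP : ∀ γ, P γ ≠ 0 := by
    intro γ h
    by_cases hγ : γ θ = θ
    · simp [P, hγ] at h
    · simp only [P, hγ, if_false] at h
      have h1 := congrArg (eval (-θ)) h
      simp [hn, add_neg_eq_zero, hγ, hA] at h1
  have hQ : (C θ + X) * ∏ γ, P γ ≠ 0 := by
    refine mul_ne_zero ?_ (Finset.prod_ne_zero_iff.2 fun γ _ => hP γ)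
    rw [add_comm]; exact X_add_C_ne_zero θ
  have : (Set.range (algebraMap F M)).Infinite :=
    Set.infinite_range_of_injective (algebraMap F M).injective
  obtain ⟨_, ⟨c, rfl⟩, hc⟩ := (this.sdiff (rootSet_finite ((C θ + X) * ∏ γ, P γ) M)).nonempty
  have hc : eval (algebraMap F M c) ((C θ + X) * ∏ γ, P γ) ≠ 0 := fun h =>
    hc ((mem_rootSet.2 ⟨hQ, by simpa using h⟩))
  rw [eval_mul, eval_prod, mul_ne_zero_iff, Finset.prod_ne_zero_iff] at hc
  refine ⟨c, by simpa using hc.1, fun γ hγ h => ?_⟩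
  have := hc.2 γ (Finset.mem_univ _)
  simp only [P, hγ, if_false] at this
  apply this
  simp only [map_mul, map_pow, map_add, AlgEquiv.commutes] at h
  simp [h]

/-- If the stabilizer of `y` is the kernel of a character with image generated by the value
at `τ`, then the conjugates of `y` are `τ y, τ² y, …` and the minimal polynomial is cyclic. -/
theorem conjugates_of_stabilizer_eq_ker [IsGalois F M] [FiniteDimensional F M]
    {A : Type*} [CommGroup A] (ψ : Gal(M/F) →* A) (τ : Gal(M/F))
    (hτ : ∀ γ, ∃ i : ℕ, ψ γ = ψ τ ^ i) {y : M} (hy : ∀ γ : Gal(M/F), γ y = y ↔ ψ γ = 1) :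
    Set.BijOn (fun i : ℕ => (τ ^ i) y) (Set.Icc 1 (orderOf (ψ τ))) ((minpoly F y).rootSet M) ∧
    IsCyclic (minpoly F y).Gal ∧
    IntermediateField.adjoin F {y} = IntermediateField.fixedField ψ.ker := by
  have hint : IsIntegral F y := Algebra.IsIntegral.isIntegral y
  have heq : ∀ γ γ' : Gal(M/F), γ y = γ' y ↔ ψ γ = ψ γ' := by
    intro γ γ'
    have := hy (γ'⁻¹ * γ)
    rw [map_mul, map_inv, inv_mul_eq_one, AlgEquiv.mul_apply,
      ← EmbeddingLike.apply_eq_iff_eq γ', ← AlgEquiv.mul_apply, mul_inv_cancel, AlgEquiv.one_apply] at this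
    rw [this, eq_comm (a := ψ γ')]
  have hroots : ∀ z ∈ (minpoly F y).rootSet M, ∃ γ : Gal(M/F), z = γ y := by
    intro z hz
    obtain ⟨γ, hγ⟩ := minpoly.exists_algEquiv_of_root' hint.isAlgebraic (mem_rootSet.1 hz).2
    exact ⟨γ, hγ.symm⟩
  have hfin : 0 < orderOf (ψ τ) := orderOf_pos_iff.2 (ψ.isOfFinOrder (isOfFinOrder_of_finite τ))
  refine ⟨⟨?_, ?_, ?_⟩, ?_, ?_⟩
  · intro i _
    refine mem_rootSet.2 ⟨minpoly.ne_zero hint, ?_⟩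
    change aeval ((τ ^ i) y) _ = 0
    rw [aeval_algHom_apply, minpoly.aeval, map_zero]
  · rintro i ⟨hi1, hi2⟩ j ⟨hj1, hj2⟩ hij
    have h := (heq _ _).1 hij
    rw [map_pow, map_pow, pow_eq_pow_iff_modEq] at h
    obtain ⟨i, rfl⟩ := Nat.exists_eq_add_of_le' hi1
    obtain ⟨j, rfl⟩ := Nat.exists_eq_add_of_le' hj1
    rw [(Nat.ModEq.add_right_cancel' 1 h).eq_of_lt_of_lt hi2 hj2]
  · intro z hz
    obtain ⟨γ, rfl⟩ := hroots z hz
    obtain ⟨i, hi⟩ := hτ γ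
    -- The index range starts at 1, so residue 0 is represented by the order itself.
    rcases Nat.eq_zero_or_pos (i % orderOf (ψ τ)) with h0 | h0
    · refine ⟨orderOf (ψ τ), ⟨hfin, le_rfl⟩, ?_⟩
      exact (heq _ _).2 (by rw [hi, map_pow, pow_orderOf_eq_one, ← pow_mod_orderOf, h0, pow_zero])
    · refine ⟨i % orderOf (ψ τ), ⟨h0, (Nat.mod_lt _ hfin).le⟩, ?_⟩
      exact (heq _ _).2 (by rw [hi, map_pow, pow_mod_orderOf])
  · have : Fact ((minpoly F y).map (algebraMap F M)).Splits := ⟨Normal.splits inferInstance y⟩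
    refine ⟨Gal.restrict _ M τ, fun s => ?_⟩
    obtain ⟨γ, rfl⟩ := Gal.restrict_surjective _ M s
    obtain ⟨i, hi⟩ := hτ γ
    refine ⟨i, ?_⟩
    change Gal.restrict _ M τ ^ (i : ℤ) = _
    rw [zpow_natCast, ← map_pow]
    apply Gal.galActionHom_injective _ M
    ext z
    change ((Gal.restrict (minpoly F y) M (τ ^ i) • z : (minpoly F y).rootSet M) : M) =
      (Gal.restrict (minpoly F y) M γ • z : (minpoly F y).rootSet M)
    rw [Gal.restrict_smul, Gal.restrict_smul]
    obtain ⟨γ', hγ'⟩ := hroots z z.2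
    rw [hγ', ← AlgEquiv.mul_apply, ← AlgEquiv.mul_apply, heq, map_mul, map_mul, map_pow, hi]
  · rw [← IsGalois.fixedField_fixingSubgroup (IntermediateField.adjoin F {y})]
    congr 1
    ext γ
    rw [MonoidHom.mem_ker, ← hy, IntermediateField.mem_fixingSubgroup_iff]
    exact IntermediateField.forall_mem_adjoin_smul_eq_self_iff F γ |>.trans (by simp)
end

/-! ### Construction of the formula from the resolvents -/

section
variable {p : ℕ} {F M : Type*} [Field F] [Field M] [Algebra F M]

theorem sum_range_natCast_zmod [NeZero p] (h : ZMod p → M) :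
    ∑ t ∈ Finset.range p, h t = ∑ j, h j := by
  refine Finset.sum_nbij' (fun t => (t : ZMod p)) ZMod.val (by simp)
    (fun j _ => Finset.mem_range.2 (ZMod.val_lt j)) ?_ (by simp) (by simp)
  intro t ht
  exact ZMod.val_cast_of_lt (Finset.mem_range.1 ht)

/-- In the setting of `exists_resolvents`, with `v` the order of `ψ τ` and `m v = 1` modulo `p`,
the product over `i` of the powers `(ρ (k δ ^ i) ^ m * s i) ^ δ ^ (v - i)`, where the `s i` are
fixed, transforms like `ρ k`. -/
theorem map_kroneckerRadical [NeZero p] (e : AddChar (ZMod p) M) (ρ : ZMod p → M) (γ : Gal(M/F))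
    {b k : ZMod p} (hb : ∀ j, γ (ρ j) = e (b * j) * ρ j) {δ v m : ℕ}
    (hδ : (δ : ZMod p) ^ v = 1) (hm : (m : ZMod p) * v = 1) {s : ℕ → M} (hs : ∀ i, γ (s i) = s i) :
    γ (∏ i ∈ Finset.Icc 1 v, (ρ (k * δ ^ i) ^ m * s i) ^ δ ^ (v - i)) =
      e (b * k) * ∏ i ∈ Finset.Icc 1 v, (ρ (k * δ ^ i) ^ m * s i) ^ δ ^ (v - i) := by
  rw [map_prod]
  -- Since `δ ^ (v - i) * δ ^ i = 1`, all `v` factors acquire the same root of unity; `m * v = 1`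
  -- then leaves `e (b * k)`.
  have h : ∀ i ∈ Finset.Icc 1 v, γ ((ρ (k * δ ^ i) ^ m * s i) ^ δ ^ (v - i)) =
      e (m * (b * k)) * (ρ (k * δ ^ i) ^ m * s i) ^ δ ^ (v - i) := by
    intro i hi
    rw [map_pow, map_mul, map_pow, hs, hb, mul_pow (e _), mul_assoc, mul_pow (e _ ^ m), ← pow_mul,
      ← AddChar.map_nsmul_eq_pow, nsmul_eq_mul]
    congr 2
    have : (δ : ZMod p) ^ (v - i) * δ ^ i = 1 := by
      rw [← pow_add, Nat.sub_add_cancel (Finset.mem_Icc.1 hi).2, hδ]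
    push_cast
    linear_combination (m * b * k : ZMod p) * this
  rw [Finset.prod_congr rfl h, Finset.prod_mul_distrib, Finset.prod_const, Nat.card_Icc,
    Nat.add_sub_cancel, ← AddChar.map_nsmul_eq_pow, nsmul_eq_mul]
  congr 2
  linear_combination (b * k : ZMod p) * hm

/-- Kronecker's formula in a Galois extension containing the resolvents. -/
theorem exists_kronecker_of_resolvents [CharZero F] [IsGalois F M] [FiniteDimensional F M]
    [hp : Fact p.Prime] {x : M} (e : AddChar (ZMod p) M) (ψ : Gal(M/F) →* (ZMod p)ˣ)
    (ρ : ZMod p → M) (he : IsPrimitiveRoot (e 1) p)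
    (hρ : ∀ γ, ∃ b, ∀ j, γ (ρ j) = e (b * j) * ρ (ψ γ * j))
    (hσ : ∃ σ, ψ σ = 1 ∧ (∀ j, σ (e j) = e j) ∧ ∃ b ≠ 0, ∀ j, σ (ρ j) = e (b * j) * ρ j)
    (hx : ∑ j, ρ j = p * x) (hk : ∃ k ≠ 0, ρ k ≠ 0) :
    ∃ (y : M) (v : ℕ) (r : ℕ → M) (δ : ℕ) (w : M) (c : ℕ → M),
      IsCyclic (minpoly F y).Gal ∧ (minpoly F y).natDegree = v ∧ v ∣ p - 1 ∧
      Set.BijOn r (Set.Icc 1 v) ((minpoly F y).rootSet M) ∧ 0 < δ ∧ orderOf (δ : ZMod p) = v ∧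
      w ^ p = ∏ i ∈ Finset.Icc 1 v, r i ^ δ ^ (v - i) ∧
      (∀ z ∈ IntermediateField.adjoin F {y}, z ^ p ≠ w ^ p) ∧
      (∀ t < p, c t ∈ IntermediateField.adjoin F {y}) ∧
      ∑ t ∈ Finset.range p, c t * w ^ t = x := by
  have : CharZero M := charZero_of_injective_algebraMap (algebraMap F M).injective
  have hp0 : (p : M) ≠ 0 := by exact_mod_cast hp.out.ne_zero
  have hep : ∀ j, e j ^ p = 1 := fun j => by
    rw [← AddChar.map_nsmul_eq_pow, nsmul_eq_mul, CharP.cast_eq_zero, zero_mul,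
      AddChar.map_zero_eq_one]
  have hej : ∀ j, e j = e 1 ^ j.val := fun j => by
    rw [← AddChar.map_nsmul_eq_pow, nsmul_eq_mul, ZMod.natCast_zmod_val, mul_one]
  have he0 : ∀ j, e j ≠ 0 := fun j h => by simpa [h, hp.out.ne_zero] using hep j
  have he1 : ∀ j, e j = 1 → j = 0 := fun j h => by
    rw [hej, he.pow_eq_one_iff_dvd] at h
    rw [← ZMod.val_eq_zero]
    exact Nat.eq_zero_of_dvd_of_lt h (ZMod.val_lt j)
  obtain ⟨k, hk0, hk⟩ := hk
  obtain ⟨⟨_, τ, rfl⟩, hτ⟩ := IsCyclic.exists_generator (α := ψ.range)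
  have hτ : ∀ γ, ∃ i : ℕ, ψ γ = ψ τ ^ i := by
    intro γ
    obtain ⟨i, hi⟩ := (mem_powers_iff_mem_zpowers).2 (hτ ⟨ψ γ, γ, rfl⟩)
    exact ⟨i, (congrArg Subtype.val hi).symm⟩
  set v := orderOf (ψ τ)
  have hvp : v ∣ p - 1 := by
    have := orderOf_dvd_card (x := ψ τ)
    rwa [ZMod.card_units_eq_totient, Nat.totient_prime hp.out] at this
  set δ : ℕ := (ψ τ : ZMod p).val with hδ
  have hδc : (δ : ZMod p) = ψ τ := ZMod.natCast_zmod_val _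
  have hδv : (δ : ZMod p) ^ v = 1 := by
    rw [hδc, ← Units.val_pow_eq_pow_val, pow_orderOf_eq_one, Units.val_one]
  have hvz : (v : ZMod p) ≠ 0 := by
    rw [Ne, ZMod.natCast_eq_zero_iff]
    intro h
    have h1 := Nat.le_of_dvd (Nat.sub_pos_of_lt hp.out.one_lt) (h.trans hvp)
    have := hp.out.pos
    omega
  set m : ℕ := ((v : ZMod p)⁻¹).val
  have hm : (m : ZMod p) * v = 1 := by
    rw [ZMod.natCast_zmod_val, inv_mul_cancel₀ hvz]
  have hρker : ∀ γ, ψ γ = 1 → ∃ b, ∀ j, γ (ρ j) = e (b * j) * ρ j := by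
    intro γ h
    obtain ⟨b, hb⟩ := hρ γ
    exact ⟨b, fun j => by rw [hb, h, Units.val_one, one_mul]⟩
  -- the radicand of the resolvent
  have hB : ∀ γ, γ (ρ k ^ p) = ρ (ψ γ * k) ^ p := by
    intro γ
    obtain ⟨b, hb⟩ := hρ γ
    rw [map_pow, hb, mul_pow, hep, one_mul]
  set K := IntermediateField.fixedField ψ.ker with hK
  have hKmem : ∀ z, z ∈ K ↔ ∀ γ, ψ γ = 1 → γ z = z := by
    intro z
    rw [hK, IntermediateField.mem_fixedField_iff]
    rfl
  have hKconj : ∀ z ∈ K, ∀ γ γ' : Gal(M/F), ψ γ = 1 → γ (γ' z) = γ' z := by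
    intro z hz γ γ' h
    have h1 := (hKmem z).1 hz (γ'⁻¹ * γ * γ') (by simp [h])
    have h2 := congrArg γ' h1
    rwa [← AlgEquiv.mul_apply, ← mul_assoc, mul_inv_cancel_left, AlgEquiv.mul_apply] at h2
  obtain ⟨θ, hθ⟩ := Field.exists_primitive_element F K
  have hθK : IntermediateField.adjoin F {(θ : M)} = K := by
    rw [← IntermediateField.lift_adjoin_simple, hθ, IntermediateField.lift_top]
  have hθfix : ∀ γ : Gal(M/F), γ θ = θ → ψ γ = 1 := by
    intro γ h
    rw [← MonoidHom.mem_ker, ← IntermediateField.fixingSubgroup_fixedField ψ.ker, ← hK, ← hθK,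
      IntermediateField.mem_fixingSubgroup_iff]
    exact (IntermediateField.forall_mem_adjoin_smul_eq_self_iff F γ).2 (by simpa using h)
  -- `(ρ k ^ p) ^ m` alone may generate less than `K`. The factor `s ^ p` makes `y` a generator and
  -- changes `w` only by factors from `K`.
  obtain ⟨a, ha0, ha⟩ := exists_translate_pow_mul_ne (F := F) ((ρ k ^ p) ^ m) (θ : M)
    (pow_ne_zero _ (pow_ne_zero _ hk)) hp.out.ne_zero
  set s : M := θ + algebraMap F M a
  have hsK : s ∈ K := add_mem θ.2 (K.algebraMap_mem a)
  set y : M := (ρ k ^ p) ^ m * s ^ p with hy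
  have hyfix : ∀ γ : Gal(M/F), γ y = y ↔ ψ γ = 1 := by
    intro γ
    constructor
    · intro h
      by_contra hγ
      exact ha γ (fun h' => hγ (hθfix γ h')) h
    · intro h
      rw [hy, map_mul, map_pow, hB, h, Units.val_one, one_mul, map_pow, (hKmem s).1 hsK γ h]
  obtain ⟨hbij, hcyc, hadj⟩ := conjugates_of_stabilizer_eq_ker ψ τ hτ hyfix
  rw [← hK] at hadj
  have hψτ : ∀ i : ℕ, (ψ (τ ^ i) : ZMod p) * k = k * δ ^ i := by
    intro i
    rw [map_pow, Units.val_pow_eq_pow_val, hδc, mul_comm]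
  have hq0 : ∀ i : ℕ, ρ (k * δ ^ i) ≠ 0 := by
    intro i h
    have := hB (τ ^ i)
    rw [hψτ, h, zero_pow hp.out.ne_zero] at this
    exact hk (eq_zero_of_pow_eq_zero ((map_eq_zero (τ ^ i)).1 this))
  set w := ∏ i ∈ Finset.Icc 1 v, (ρ (k * δ ^ i) ^ m * (τ ^ i) s) ^ δ ^ (v - i) with hw
  have hw0 : w ≠ 0 := Finset.prod_ne_zero_iff.2 fun i _ =>
    pow_ne_zero _ (mul_ne_zero (pow_ne_zero _ (hq0 i)) ((_root_.map_ne_zero (τ ^ i)).2 ha0))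
  have hwmap : ∀ γ, ψ γ = 1 → ∀ b, (∀ j, γ (ρ j) = e (b * j) * ρ j) → γ w = e (b * k) * w :=
    fun γ h b hb => map_kroneckerRadical e ρ γ hb hδv hm fun i => hKconj s hsK γ (τ ^ i) h
  -- Under `ker ψ`, `ρ (k * t)` and `w ^ t` acquire the same root of unity, so their quotient lies
  -- in `K`.
  refine ⟨y, v, fun i => (τ ^ i) y, δ, w, fun t => ρ (k * t) / (p * w ^ t), hcyc, ?_, hvp, hbij,
    ?_, ?_, ?_, ?_, ?_, ?_⟩
  · have hint : IsIntegral F y := Algebra.IsIntegral.isIntegral y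
    rw [← card_rootSet_eq_natDegree (minpoly.irreducible hint).separable
      (Normal.splits (inferInstance : Normal F M) y), ← Nat.card_eq_fintype_card,
      Nat.card_coe_set_eq, ← hbij.image_eq, hbij.injOn.ncard_image, ← Finset.coe_Icc,
      Set.ncard_coe_finset, Nat.card_Icc, Nat.add_sub_cancel]
  · rw [hδ, Nat.pos_iff_ne_zero, Ne, ZMod.val_eq_zero]
    exact (ψ τ).ne_zero
  · rw [hδc, orderOf_units]
  · rw [hw, ← Finset.prod_pow]
    refine Finset.prod_congr rfl fun i _ => ?_
    have hr : (τ ^ i) y = (ρ (k * δ ^ i) ^ m * (τ ^ i) s) ^ p := by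
      rw [hy, map_mul, map_pow, hB, hψτ, map_pow, mul_pow, pow_right_comm]
    rw [pow_right_comm, ← hr]
  -- If `z ^ p = w ^ p`, then `w` is a root of unity times `z`, hence fixed by `σ`; but `σ`
  -- multiplies `w` by `e (b * k) ≠ 1`.
  · intro z hz hzw
    rw [hadj, hKmem] at hz
    obtain ⟨σ, hσ1, hσe, b, hb0, hb⟩ := hσ
    have hz0 : z ≠ 0 := by
      rintro rfl
      rw [zero_pow hp.out.ne_zero] at hzw
      exact pow_ne_zero p hw0 hzw.symm
    obtain ⟨i, -, hi⟩ := he.eq_pow_of_pow_eq_one (ξ := w / z)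
      (by rw [div_pow, hzw, div_self (pow_ne_zero p hw0)])
    have h1 : w = e 1 ^ i * z := by rw [hi, div_mul_cancel₀ _ hz0]
    have h2 := hwmap σ hσ1 b hb
    have h3 : σ w = w := by rw [h1, map_mul, map_pow, hσe, hz σ hσ1]
    rw [h3] at h2
    exact mul_ne_zero hb0 hk0 (he1 _ (mul_right_cancel₀ hw0 (by rw [one_mul, ← h2])))
  · intro t _
    rw [hadj, hKmem]
    intro γ h
    obtain ⟨b, hb⟩ := hρker γ h
    rw [map_div₀, map_mul, map_natCast, map_pow, hwmap γ h b hb, hb, mul_pow,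
      ← AddChar.map_nsmul_eq_pow, nsmul_eq_mul,
      show (t : ZMod p) * (b * k) = b * (k * t) by ring, mul_left_comm (p : M),
      mul_div_mul_left _ _ (he0 _)]
  · have h1 : ∀ t ∈ Finset.range p, ρ (k * t) / (p * w ^ t) * w ^ t = (p : M)⁻¹ * ρ (k * t) := by
      intro t _
      field_simp
    rw [Finset.sum_congr rfl h1, ← Finset.mul_sum, sum_range_natCast_zmod fun j => ρ (k * j),
      Fintype.sum_equiv (Units.mulLeft (Units.mk0 k hk0)) (fun j => ρ (k * j)) ρ
        (fun _ => rfl), hx, inv_mul_cancel_left₀ hp0]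
end

/-! ### Passage to an algebraically closed field and conclusion -/

/-- Existence of Kronecker's formula in an algebraically closed extension, by means of a solvable
Galois extension `M` in which `g` and `X ^ p - 1` split. -/
theorem exists_kronecker_of_splits {F M E : Type*} [Field F] [CharZero F] [Field M] [Algebra F M]
    [IsGalois F M] [FiniteDimensional F M] [Group.IsSolvable Gal(M/F)] [Field E] [Algebra F E]
    [IsAlgClosed E] {p : ℕ} (hp : p.Prime) {g : F[X]} (hirr : Irreducible g)
    (hdeg : g.natDegree = p) (hgs : (g.map (algebraMap F M)).Splits)
    (hXs : ((X ^ p - 1 : F[X]).map (algebraMap F M)).Splits) :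
    ∃ (f : F[X]) (v : ℕ) (r : ℕ → E) (δ : ℕ) (w : E) (c : ℕ → E),
      f.Monic ∧ Irreducible f ∧ IsCyclic f.Gal ∧ f.natDegree = v ∧ v ∣ p - 1 ∧
      Set.BijOn r (Set.Icc 1 v) (f.rootSet E) ∧ 0 < δ ∧ orderOf (δ : ZMod p) = v ∧
      w ^ p = ∏ i ∈ Finset.Icc 1 v, r i ^ δ ^ (v - i) ∧
      (∀ z ∈ IntermediateField.adjoin F (r '' Set.Icc 1 v), z ^ p ≠ w ^ p) ∧
      (∀ t < p, c t ∈ IntermediateField.adjoin F (r '' Set.Icc 1 v)) ∧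
      aeval (∑ t ∈ Finset.range p, c t * w ^ t) g = 0 := by
  have : Fact p.Prime := ⟨hp⟩
  have : CharZero M := charZero_of_injective_algebraMap (algebraMap F M).injective
  obtain ⟨ζ, hζ⟩ : ∃ ζ : M, IsPrimitiveRoot ζ p := by
    have hsep : (X ^ p - 1 : F[X]).Separable :=
      X_pow_sub_one_separable_iff.2 (by exact_mod_cast hp.ne_zero)
    have hc := card_rootSet_eq_natDegree hsep hXs
    have hn : (X ^ p - 1 : F[X]).natDegree = p := natDegree_X_pow_sub_C (r := (1 : F))
    have h1 : (1 : M) ∈ (X ^ p - 1 : F[X]).rootSet M :=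
      mem_rootSet.2 ⟨hsep.ne_zero, by simp⟩
    obtain ⟨z, hz⟩ := Fintype.exists_ne_of_one_lt_card (by rw [hc, hn]; exact hp.one_lt)
      (⟨1, h1⟩ : (X ^ p - 1 : F[X]).rootSet M)
    have hzp : (z : M) ^ p = 1 := by simpa [sub_eq_zero] using (mem_rootSet.1 z.2).2
    refine ⟨z, ?_⟩
    have hord := orderOf_eq_prime hzp fun h => hz (Subtype.ext h)
    exact IsPrimitiveRoot.iff_orderOf.2 hord
  have hcard : Nat.card (g.rootSet M) = p := by
    rw [Nat.card_eq_fintype_card, card_rootSet_eq_natDegree hirr.separable hgs, hdeg]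
  have : MulAction.IsPretransitive Gal(M/F) (g.rootSet M) := by
    refine ⟨fun x y => ?_⟩
    obtain ⟨γ, hγ⟩ := minpoly.exists_algEquiv_of_root' (K := F) (x := (y : M)) (y := (x : M))
      (Algebra.IsAlgebraic.isAlgebraic _) (by
        rw [← minpoly.eq_of_irreducible hirr (mem_rootSet.1 x.2).2, map_mul,
          (mem_rootSet.1 y.2).2, zero_mul])
    exact ⟨γ, Subtype.ext hγ⟩
  obtain ⟨x, a, ha, hσ⟩ := exists_affine_of_solvable_of_prime_card (Γ := Gal(M/F)) hp hcard
  obtain ⟨e, ψ, ρ, he, hρ, hσ', hsum, hk⟩ := exists_resolvents hζ (x := fun i => (x i : M))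
    (fun i j h => x.injective (Subtype.ext h)) a
    (fun γ => (ha γ).imp fun b hb i => congrArg Subtype.val (hb i))
    (hσ.imp fun σ h i => congrArg Subtype.val (h i))
  obtain ⟨y, v, r, δ, w, c, hcyc, hdegf, hdvd, hbij, hpos, hord, hw, hnp, hc, hxw⟩ :=
    exists_kronecker_of_resolvents e ψ ρ he hρ hσ' hsum hk
  -- As `M` is normal, `ι` carries the roots of `minpoly F y` in `M` onto all those in `E`, and
  -- `F(y)` onto the field they generate.
  let ι : M →ₐ[F] E := IsAlgClosed.lift
  have hint : IsIntegral F y := Algebra.IsIntegral.isIntegral y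
  have hf := minpoly.irreducible hint
  have hroots : ι '' ((minpoly F y).rootSet M) = (minpoly F y).rootSet E :=
    (Normal.splits (inferInstance : Normal F M) y).image_rootSet ι
  have hbij' : Set.BijOn (fun i => ι (r i)) (Set.Icc 1 v) ((minpoly F y).rootSet E) := by
    rw [← hroots]
    exact (ι.injective.injOn.bijOn_image).comp hbij
  have hadj : IntermediateField.adjoin F ((fun i => ι (r i)) '' Set.Icc 1 v) =
      (IntermediateField.adjoin F {y}).map ι := by
    rw [hbij'.image_eq, adjoin_rootSet_eq_adjoin_root (x := ι y) hf hf.separable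
      (IsAlgClosed.splits _) hcyc, IntermediateField.adjoin_map, Set.image_singleton]
    rw [← hroots]
    exact ⟨y, mem_rootSet.2 ⟨hf.ne_zero, minpoly.aeval F y⟩, rfl⟩
  refine ⟨minpoly F y, v, fun i => ι (r i), δ, ι w, fun t => ι (c t), minpoly.monic hint, hf,
    hcyc, hdegf, hdvd, hbij', hpos, hord, ?_, ?_, ?_, ?_⟩
  · rw [← map_pow, hw, map_prod]
    simp only [map_pow]
  · rw [hadj]
    rintro _ ⟨z, hz, rfl⟩ h
    refine hnp z hz (ι.injective ?_)
    rw [map_pow, map_pow]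
    exact h
  · intro t ht
    rw [hadj]
    exact ⟨c t, hc t ht, rfl⟩
  · simp only [← map_pow, ← map_mul, ← map_sum]
    rw [hxw, aeval_algHom_apply, (mem_rootSet.1 (x 0).2).2, map_zero]

/-- Existence of Kronecker's formula in an algebraically closed extension. -/
theorem exists_kronecker_of_isSolvable {F E : Type*} [Field F] [CharZero F] [Field E] [Algebra F E]
    [IsAlgClosed E] {p : ℕ} (hp : p.Prime) {g : F[X]} (hirr : Irreducible g)
    (hdeg : g.natDegree = p) (hsolv : Group.IsSolvable g.Gal) :
    ∃ (f : F[X]) (v : ℕ) (r : ℕ → E) (δ : ℕ) (w : E) (c : ℕ → E),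
      f.Monic ∧ Irreducible f ∧ IsCyclic f.Gal ∧ f.natDegree = v ∧ v ∣ p - 1 ∧
      Set.BijOn r (Set.Icc 1 v) (f.rootSet E) ∧ 0 < δ ∧ orderOf (δ : ZMod p) = v ∧
      w ^ p = ∏ i ∈ Finset.Icc 1 v, r i ^ δ ^ (v - i) ∧
      (∀ z ∈ IntermediateField.adjoin F (r '' Set.Icc 1 v), z ^ p ≠ w ^ p) ∧
      (∀ t < p, c t ∈ IntermediateField.adjoin F (r '' Set.Icc 1 v)) ∧
      aeval (∑ t ∈ Finset.range p, c t * w ^ t) g = 0 := by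
  -- Adjoining the `p`-th roots of unity keeps the group solvable.
  obtain ⟨G, hG⟩ : ∃ G : F[X], G = g * (X ^ p - 1) := ⟨_, rfl⟩
  have hG0 : G ≠ 0 := hG ▸ mul_ne_zero hirr.ne_zero
    (by simpa using X_pow_sub_C_ne_zero hp.pos (1 : F))
  have hGs : Group.IsSolvable G.Gal :=
    hG ▸ gal_mul_isSolvable hsolv (gal_X_pow_sub_one_isSolvable p)
  obtain ⟨M, hM⟩ : ∃ M : IntermediateField F E, IsSplittingField F M G :=
    ⟨_, IntermediateField.adjoin_rootSet_isSplittingField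
      (IsAlgClosed.splits (G.map (algebraMap F E)))⟩
  have : FiniteDimensional F M := IsSplittingField.finiteDimensional M G
  have : Normal F M := Normal.of_isSplittingField G
  have : IsGalois F M := {}
  have : Group.IsSolvable Gal(M/F) :=
    Group.isSolvable_of_surjective
      (G := G.Gal)
      (f := (AlgEquiv.autCongr (IsSplittingField.algEquiv M G).symm : G.Gal ≃* Gal(M/F)).toMonoidHom)
      (MulEquiv.surjective _)
  have hsp := IsSplittingField.splits M G
  have hGm0 : G.map (algebraMap F M) ≠ 0 := map_ne_zero hG0
  have hg : g ∣ G := Dvd.intro _ hG.symm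
  have hX : X ^ p - 1 ∣ G := Dvd.intro_left _ hG.symm
  exact exists_kronecker_of_splits (M := M) hp hirr hdeg
    (hsp.of_dvd hGm0 (Polynomial.map_dvd _ hg)) (hsp.of_dvd hGm0 (Polynomial.map_dvd _ hX))

theorem mainTheorem7 (g : ℚ[X]) (μ : ℕ) (hμ : μ.Prime) (hodd : Odd μ) (hdeg : g.natDegree = μ)
    (hirr : Irreducible g) (hsolv : IsSolvableByRadicals g) :
    (∃ (f : ℚ[X]) (v : ℕ) (r : ℕ → ℂ) (δ : ℕ) (w : ℂ) (c : ℕ → ℂ),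
      IsKroneckerFormula g μ f v r δ w c) ∧
    ∀ (f : ℚ[X]) (v : ℕ) (r : ℕ → ℂ) (δ : ℕ) (w : ℂ) (c : ℕ → ℂ),
      IsKroneckerFormula g μ f v r δ w c →
        (∀ t < μ, c t ∈ IntermediateField.adjoin ℚ {r 1}) ∧
        Set.BijOn
          (fun j : ℕ => ∑ t ∈ Finset.range μ,
            c t * (w * Complex.exp (2 * Real.pi * Complex.I * j / μ)) ^ t)
          (Set.Icc 1 μ) (g.rootSet ℂ) := by
  constructor
  · obtain ⟨x, hx⟩ := IsAlgClosed.exists_aeval_eq_zero ℂ g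
      (degree_ne_of_natDegree_ne (hdeg ▸ hμ.ne_zero))
    -- One root in radicals suffices for the solvability of the group, as `g` is irreducible.
    obtain ⟨f, v, r, δ, w, c, h1, h2, h3, h4, h5, h6, h7, h8, h9, h10, h11, h12⟩ :=
      exists_kronecker_of_isSolvable (E := ℂ) hμ hirr hdeg
        (isSolvable_gal_of_irreducible (hsolv x (mem_rootSet.2 ⟨hirr.ne_zero, hx⟩)) hirr hx)
    exact ⟨f, v, r, δ, w, c, h1, h2, h3, h4, h5, h6, h7, h8, h9, h10, h11, h12⟩
  · intro f v r δ w c h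
    exact ⟨fun t ht => h.adjoin_eq ▸ h.coeff_mem t ht, h.bijOn hμ hdeg hirr⟩
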